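/- **Conventions.** Let $\mathbb T=\mathbb R\cup\{\infty\}$ with $a\odot b=a+b$, $a\oplus b=\min\{a,b\}$ and the order topology. For a finite set $E$ let $\mathbb P(\mathbb T^E)=(\mathbb T^E\setminus\{(\infty,\dots,\infty)\})/\mathbb R\mathbf 1$ with the quotient topology. A tropical relation $\bigoplus_j m_j$ holds at a point if the minimum of the terms $m_j$ is achieved at least twice (this is understood to hold if all terms are $\infty$). The Dressian $Dr(r;n)\subset\mathbb P(\mathbb T^{\binom{[n]}{r}})$ is the set of points satisfying the tropical Grassmann–Plücker relations $$P_I\odot P_J\oplus\bigoplus_{j\in J\setminus I}P_{I\setminus i\cup j}\odot P_{J\setminus j\cup i}\qquad \Big(I,J\in\tbinom{[n]}{r},\ |I\cap J|<r-1,\ i\in I\setminus J\Big).$$ The flag Dressian $FlDr(r,r+1;n)\subset \mathbb P(\mathbb T^{\binom{[n]}{r}})\times\mathbb P(\mathbb T^{\binom{[n]}{r+1}})$ is the set of points $(\overline{\mu'},\overline{\mu})$ such that $\overline{\mu'}\in Dr(r;n)$, $\overline{\mu}\in Dr(r+1;n)$ and the tropical incidence-Plücker relations $$\bigoplus_{j\in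 J'\setminus I'}P_{I'\cup j}\odot P_{J'\setminus j}\qquad \Big(I'\in\tbinom{[n]}{r-1},\ J'\in\tbinom{[n]}{r+2}\Big)$$ hold, where the first factors are coordinates of $\mu'$ and the second factors are coordinates of $\mu$. **Theorem.** Let $0\le r<r+1\le n$, $[n]=\{1,\dots,n\}$ and $[\widetilde n]=\{0,1,\dots,n\}$, and regard $Dr(r+1;n+1)$ as a subset of $\mathbb P(\mathbb T^{\binom{[\widetilde n]}{r+1}})$. Splitting off the new element $0$, that is, $u\mapsto\big((u_{I\cup 0})_{I\in\binom{[n]}{r}},(u_J)_{J\in\binom{[n]}{r+1}}\big)$, identifies vectors indexed by $\binom{[\widetilde n]}{r+1}$ with pairs of vectors indexed by $\binom{[n]}{r}$ and $\binom{[n]}{r+1}$. It induces a well-defined map to $\mathbb P(\mathbb T^{\binom{[n]}{r}})\times\mathbb P(\mathbb T^{\binom{[n]}{r+1}})$ on the set $\Omega\subset\mathbb P(\mathbb T^{\binom{[\widetilde n]}{r+1}})$ of classes $\overline u$ such that $u_I\ne\infty$ for some $I\ni 0$ and $u_J\neq\infty$ for some $J\not\ni 0$. This map restricts to a well-defined surjective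 map $$\pi:\ \Omega\cap Dr(r+1;n+1)\longrightarrow FlDr(r,r+1;n).$$ For every $(\overline{\mu'},\overline{\mu})\in FlDr(r,r+1;n)$ the fiber of $\pi$ is $$\pi^{-1}(\overline{\mu'},\overline\mu)=\{\overline{a\odot\mu'\oplus b\odot\mu}\ :\ a,b\in\mathbb R\},$$ where $\mu'$ and $\mu$ are regarded as vectors indexed by $\binom{[\widetilde n]}{r+1}$ by $\mu'(I)=\mu'(I\setminus 0)$ if $I\ni 0$ and $\mu'(I)=\infty$ otherwise, and by $\mu(J)=\infty$ if $J\ni 0$. Moreover $(a,b)\mapsto\overline{a\odot\mu'\oplus b\odot\mu}$ induces a homeomorphism of $\mathbb R^2/\mathbb R(1,1)$ onto the fiber, and $\overline{a\odot\mu'\oplus b\odot\mu}\mapsto a-b$ is a homeomorphism of the fiber onto $\mathbb R$. -/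

import Mathlib

namespace FlagDressian

/-- The tropical numbers `𝕋 = ℝ ∪ {∞}`, in the min-plus convention: `a ⊙ b` is `a + b`,
`a ⊕ b` is `min a b`, and the topology is the order topology. -/
abbrev Trop : Type := WithTop ℝ

/-- The vectors in `𝕋^E` other than `(∞, …, ∞)`, as a subspace of the product `𝕋^E`. -/
abbrev TropVec (E : Type) : Type := {u : E → Trop // ∃ e, u e ≠ ⊤}

/-- `u ∼ u'` if `u' = u + c𝟏` for some real `c`. -/
instance TropVec.setoid (E : Type) : Setoid (TropVec E) where
  r u u' := ∃ c : ℝ, ∀ e, u'.1 e = u.1 e + (c : Trop)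
  iseqv := by
    refine ⟨fun u => ⟨0, fun e => by simp⟩, ?_, ?_⟩
    · rintro u v ⟨c, h⟩
      refine ⟨-c, fun e => ?_⟩
      rw [h e, add_assoc, ← WithTop.coe_add]
      simp
    · rintro u v w ⟨c, h⟩ ⟨d, h'⟩
      refine ⟨c + d, fun e => ?_⟩
      rw [h' e, h e, add_assoc, ← WithTop.coe_add]

/-- Tropical projective space `ℙ(𝕋^E)`, with the quotient topology. -/
def TropProj (E : Type) : Type := Quotient (TropVec.setoid E)

instance (E : Type) : TopologicalSpace (TropProj E) :=
  inferInstanceAs (TopologicalSpace (Quotient (TropVec.setoid E)))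

/-- The class of a vector in tropical projective space. -/
def TropProj.mk {E : Type} (u : TropVec E) : TropProj E := Quotient.mk _ u

/-- The tropical scalar multiple `a ⊙ u`, for a real number `a`. -/
def TropVec.scale {E : Type} (a : ℝ) (u : TropVec E) : TropVec E :=
  ⟨fun e => (a : Trop) + u.1 e, u.2.imp fun _ he => by simpa using he⟩

/-- The tropical sum `u ⊕ v`. -/
def TropVec.oplus {E : Type} (u v : TropVec E) : TropVec E :=
  ⟨fun e => min (u.1 e) (v.1 e), u.2.imp fun _ he => by simp [he]⟩

/-- The minimum of the terms `f j`, `j ∈ s`, is achieved at least twice;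
by convention this holds if all the terms are `∞`. -/
def MinTwice {ι : Type} (s : Finset ι) (f : ι → Trop) : Prop :=
  (∀ i ∈ s, f i = ⊤) ∨ ∃ i ∈ s, ∃ j ∈ s, i ≠ j ∧ f i = f j ∧ ∀ k ∈ s, f i ≤ f k

/-- The `r`-element subsets of a ground set of `n` elements. -/
abbrev Sub (n r : ℕ) : Type := {I : Finset (Fin n) // I.card = r}

/-- The coordinate `P_S` of a vector indexed by the `r`-element sets; it is only ever meaningful
for sets `S` with `r` elements, and is `∞` for all other sets. -/
def coord {n r : ℕ} (u : Sub n r → Trop) (S : Finset (Fin n)) : Trop :=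
  if h : S.card = r then u ⟨S, h⟩ else ⊤

/-- The tropical Grassmann-Plücker relations: for all `r`-element sets `I`, `J` with
`|I ∩ J| < r - 1` and all `i ∈ I \ J`, the minimum in
`P_I ⊙ P_J ⊕ ⨁_{j ∈ J \ I} P_{I \ i ∪ j} ⊙ P_{J \ j ∪ i}` is achieved at least twice.
The first term is the one with index `j = i` below. The monomials are pairwise distinct. -/
def SatisfiesGP {n r : ℕ} (u : Sub n r → Trop) : Prop :=
  ∀ I J : Finset (Fin n), I.card = r → J.card = r → (I ∩ J).card + 1 < r → ∀ i ∈ I \ J,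
    MinTwice (insert i (J \ I)) fun j =>
      coord u (insert j (I.erase i)) + coord u ((insert i J).erase j)

/-- The tropical incidence-Plücker relations: for all sets `I'` with `r - 1` elements and `J'`
with `s + 1` elements, the minimum in `⨁_{j ∈ J' \ I'} P_{I' ∪ j} ⊙ P_{J' \ j}` is achieved
at least twice. (There is no such `I'` if `r = 0`.) The monomials are pairwise distinct
if `r < s`. -/
def SatisfiesIP {n r s : ℕ} (u : Sub n r → Trop) (v : Sub n s → Trop) : Prop :=
  ∀ I' J' : Finset (Fin n), I'.card + 1 = r → J'.card = s + 1 →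
    MinTwice (J' \ I') fun j => coord u (insert j I') + coord v (J'.erase j)

/-- The Dressian `Dr(r; n)` in `ℙ(𝕋^{n choose r})`. -/
def Dr (r n : ℕ) : Set (TropProj (Sub n r)) :=
  {p | ∃ u : TropVec (Sub n r), TropProj.mk u = p ∧ SatisfiesGP u.1}

/-- The flag Dressian `FlDr(r, s; n)` in `ℙ(𝕋^{n choose r}) × ℙ(𝕋^{n choose s})`. -/
def FlDr (r s n : ℕ) : Set (TropProj (Sub n r) × TropProj (Sub n s)) :=
  {p | ∃ (u : TropVec (Sub n r)) (v : TropVec (Sub n s)),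
    (TropProj.mk u, TropProj.mk v) = p ∧
      SatisfiesGP u.1 ∧ SatisfiesGP v.1 ∧ SatisfiesIP u.1 v.1}

/-! The ground set `{0, 1, …, n}` is `Fin (n + 1)`, with new element `0`; the ground set
`{1, …, n}` is `Fin n`, embedded in `Fin (n + 1)` by `Fin.succ`. -/

/-- `I ↦ I ∪ 0`. -/
def withZero {n r : ℕ} (I : Sub n r) : Sub (n + 1) (r + 1) :=
  ⟨insert 0 (I.1.map (Fin.succEmb n)), by
    rw [Finset.card_insert_of_notMem (by simp [Fin.succ_ne_zero]), Finset.card_map, I.2]⟩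

/-- `J ↦ J`, as a set that does not contain `0`. -/
def withoutZero {n r : ℕ} (J : Sub n r) : Sub (n + 1) r :=
  ⟨J.1.map (Fin.succEmb n), by rw [Finset.card_map, J.2]⟩

/-- The identification of vectors indexed by the `(r+1)`-subsets of `{0, …, n}` with pairs of
vectors indexed by the `r`-subsets and the `(r+1)`-subsets of `{1, …, n}`:
`u ↦ (u_{I ∪ 0})_I × (u_J)_J`. -/
def split {A : Type} {n r : ℕ} (u : Sub (n + 1) (r + 1) → A) :
    (Sub n r → A) × (Sub n (r + 1) → A) :=
  (fun I => u (withZero I), fun J => u (withoutZero J))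

/-- The set on which the map of projective spaces induced by `split` is defined. -/
def Omega (r n : ℕ) : Set (TropProj (Sub (n + 1) (r + 1))) :=
  {p | ∃ u : TropVec (Sub (n + 1) (r + 1)), TropProj.mk u = p ∧
    (∃ I, 0 ∈ I.1 ∧ u.1 I ≠ ⊤) ∧ (∃ J, 0 ∉ J.1 ∧ u.1 J ≠ ⊤)}

/-- The part in `{1, …, n}` of a subset of `{0, …, n}`. -/
def dropZero {n : ℕ} (S : Finset (Fin (n + 1))) : Finset (Fin n) :=
  Finset.univ.filter fun i => i.succ ∈ S

theorem dropZero_withZero {n r : ℕ} (I : Sub n r) : dropZero (withZero I).1 = I.1 := by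
  ext i
  simp [dropZero, withZero, Fin.succ_ne_zero]

theorem dropZero_withoutZero {n r : ℕ} (J : Sub n r) : dropZero (withoutZero J).1 = J.1 := by
  ext i
  simp [dropZero, withoutZero]

/-- `μ'` as a vector on `{0, …, n}`: the value at `I` is `μ'(I \ 0)` if `0 ∈ I`, and `∞`
otherwise. -/
def extendWith {n r : ℕ} (μ' : TropVec (Sub n r)) : TropVec (Sub (n + 1) (r + 1)) :=
  ⟨fun I => if 0 ∈ I.1 then coord μ'.1 (dropZero I.1) else ⊤, by
    obtain ⟨I, hI⟩ := μ'.2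
    refine ⟨withZero I, ?_⟩
    show (if 0 ∈ (withZero I).1 then coord μ'.1 (dropZero (withZero I).1) else ⊤) ≠ ⊤
    rw [dropZero_withZero]
    simpa [withZero, coord, I.2] using hI⟩

/-- `μ` as a vector on `{0, …, n}`: the value at `J` is `μ(J)` if `0 ∉ J`, and `∞` otherwise. -/
def extendWithout {n r : ℕ} (μ : TropVec (Sub n (r + 1))) : TropVec (Sub (n + 1) (r + 1)) :=
  ⟨fun J => if 0 ∈ J.1 then ⊤ else coord μ.1 (dropZero J.1), by
    obtain ⟨J, hJ⟩ := μ.2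
    refine ⟨withoutZero J, ?_⟩
    show (if 0 ∈ (withoutZero J).1 then ⊤ else coord μ.1 (dropZero (withoutZero J).1)) ≠ ⊤
    rw [dropZero_withoutZero]
    simpa [withoutZero, coord, J.2, Fin.succ_ne_zero] using hJ⟩

/-- The class of `a ⊙ μ' ⊕ b ⊙ μ`. -/
def fiberPoint {n r : ℕ} (μ' : TropVec (Sub n r)) (μ : TropVec (Sub n (r + 1))) (a b : ℝ) :
    TropProj (Sub (n + 1) (r + 1)) :=
  TropProj.mk (((extendWith μ').scale a).oplus ((extendWithout μ).scale b))

end FlagDressian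

/-!
The Grassmann-Plücker and the incidence-Plücker relations are both instances of one exchange
property `Exchange f g` of functions on finite sets (`satisfiesGP_iff`, `satisfiesIP_iff`): this
property with `f = g` is the former, and with two different functions the latter. For a vector `u`
on `{0, …, n}` with parts `μ'` (sets containing `0`) and `μ` (sets avoiding `0`), the exchange
property of `u` for a pair `(I, J)` is that of `μ'` if `0 ∈ I ∩ J`, that of `μ` if `0 ∉ I ∪ J`, and
for `0 ∈ I \ J` and an exchanged element other than `0` it is that of the pair `(μ', μ)`. Hence `π`
maps into the flag Dressian.

The point of the converse is that the remaining relations, for `0 ∈ J \ I` or for the exchange of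
`0` itself, follow from these. At distance two (three-term relations) they coincide with incidence
relations. Murota's argument that local exchange implies global exchange
(`exchange_of_local`) extends them to all distances. Its usual hypothesis that the support of `u`
is a matroid is replaced by a weaker condition on the support, which is checked directly from the
relations for `μ'`, `μ` and `(μ', μ)` (`exists_finite_exchange`, `exchange_of_cone_up`). The result
is `satisfiesGP_iff_split`: `u` lies in the Dressian if and only if `(μ', μ)` lies in the flag
Dressian. This gives surjectivity. The two parts of `u` are rescaled independently in the target,
so the fiber consists of the classes of `a ⊙ μ' ⊕ b ⊙ μ`.

The class of `a ⊙ μ' ⊕ b ⊙ μ` depends only on `a - b`, which is recovered continuously as a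
difference of two coordinates, one where `μ'` and one where `μ` is finite
(`continuousOn_coordDiff`, `exists_homeomorph_of_image_eq`).
-/

namespace FlagDressian

/-! ### Plücker relations as exchange properties -/

theorem minTwice_iff {ι : Type} {s : Finset ι} {f : ι → Trop} :
    MinTwice s f ↔ ∀ i ∈ s, f i ≠ ⊤ → ∃ j ∈ s, j ≠ i ∧ f j ≤ f i := by
  constructor
  · rintro (h | ⟨a, ha, b, hb, hab, hfab, hmin⟩) i hi hfi
    · exact absurd (h i hi) hfi
    · by_cases hai : a = i
      · exact ⟨b, hb, fun h => hab (hai.trans h.symm), hfab ▸ hmin i hi⟩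
      · exact ⟨a, ha, hai, hmin i hi⟩
  · intro h
    rcases s.eq_empty_or_nonempty with rfl | hs
    · left; simp
    obtain ⟨i, hi, hmin⟩ := s.exists_min_image f hs
    by_cases hfi : f i = ⊤
    · left
      intro k hk
      exact top_le_iff.1 (hfi ▸ hmin k hk)
    · obtain ⟨j, hj, hji, hle⟩ := h i hi hfi
      exact .inr ⟨i, hi, j, hj, hji.symm, le_antisymm (hmin j hj) hle, hmin⟩

/-- The exchange property of a pair of functions on finite sets, in the form used for valuated
matroids: an element `i` of `I \ J` can be exchanged for some `j ∈ J \ I` without increasing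
`f I + g J`. Nothing is required if `f I + g J = ∞`. -/
def Exchange {α : Type} [DecidableEq α] (f g : Finset α → Trop) : Prop :=
  ∀ I J : Finset α, ∀ i ∈ I, i ∉ J → f I + g J ≠ ⊤ →
    ∃ j ∈ J, j ∉ I ∧ f (insert j (I.erase i)) + g (insert i (J.erase j)) ≤ f I + g J

theorem insert_erase_eq_of_sdiff {α : Type} [DecidableEq α] {I J : Finset α} {i j : α}
    (hi : I \ J = {i}) (hj : J \ I = {j}) : insert j (I.erase i) = J := by
  ext x
  have h1 := Finset.ext_iff.1 hi x
  have h2 := Finset.ext_iff.1 hj x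
  have h3 := Finset.ext_iff.1 hi j
  have h4 := Finset.ext_iff.1 hj j
  simp only [Finset.mem_sdiff, Finset.mem_singleton, Finset.mem_insert, Finset.mem_erase] at *
  grind

/-- At distance one, the only exchange interchanges `I` and `J`. -/
theorem exchange_of_card_sdiff_eq_one {α : Type} [DecidableEq α] (f : Finset α → Trop)
    {I J : Finset α} (hI : (I \ J).card = 1) (hJ : (J \ I).card = 1) {i : α} (hi : i ∈ I)
    (hiJ : i ∉ J) :
    ∃ j ∈ J, j ∉ I ∧ f (insert j (I.erase i)) + f (insert i (J.erase j)) ≤ f I + f J := by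
  obtain ⟨a, ha⟩ := Finset.card_eq_one.1 hI
  obtain ⟨j, hj⟩ := Finset.card_eq_one.1 hJ
  obtain rfl : i = a := Finset.mem_singleton.1 (ha ▸ Finset.mem_sdiff.2 ⟨hi, hiJ⟩)
  obtain ⟨hjJ, hjI⟩ := Finset.mem_sdiff.1 (hj ▸ Finset.mem_singleton_self j)
  refine ⟨j, hjJ, hjI, ?_⟩
  rw [insert_erase_eq_of_sdiff ha hj, insert_erase_eq_of_sdiff hj ha, add_comm]

theorem card_of_coord_ne_top {n r : ℕ} {u : Sub n r → Trop} {S : Finset (Fin n)}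
    (h : coord u S ≠ ⊤) : S.card = r := by
  by_contra hS
  exact h (dif_neg hS)

theorem satisfiesIP_iff {n r s : ℕ} {u : Sub n r → Trop} {v : Sub n s → Trop} :
    SatisfiesIP u v ↔ Exchange (coord u) (coord v) := by
  constructor
  · intro h I J i hi hiJ hfin
    have hI := card_of_coord_ne_top (WithTop.add_ne_top.1 hfin).1
    have hJ := card_of_coord_ne_top (WithTop.add_ne_top.1 hfin).2
    have h1 : insert i (I.erase i) = I := Finset.insert_erase hi
    have h2 : (insert i J).erase i = J := Finset.erase_insert hiJ
    obtain ⟨j, hj, hji, hle⟩ := minTwice_iff.1 (h (I.erase i) (insert i J)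
      (by rw [Finset.card_erase_add_one hi, hI]) (by rw [Finset.card_insert_of_notMem hiJ, hJ]))
      i (by simp) (by rwa [h1, h2])
    rw [h1, h2, Finset.erase_insert_of_ne hji.symm] at hle
    refine ⟨j, ?_, ?_, hle⟩ <;> clear * - hj hji <;> grind
  · intro h A B hA hB
    rw [minTwice_iff]
    intro i hi hfin
    obtain ⟨hiB, hiA⟩ := Finset.mem_sdiff.1 hi
    obtain ⟨j, hj, hjI, hle⟩ := h (insert i A) (B.erase i) i (by simp) (by simp) hfin
    have hji : j ≠ i := fun h => hjI (h ▸ Finset.mem_insert_self _ _)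
    rw [Finset.erase_insert hiA, Finset.erase_right_comm,
      Finset.insert_erase (Finset.mem_erase.2 ⟨hji.symm, hiB⟩)] at hle
    exact ⟨j, by clear * - hj hjI; grind, hji, hle⟩

/-- The pairs with `|I ∩ J| = r - 1`, which the Grassmann-Plücker relations leave out, satisfy the
exchange property trivially. -/
theorem satisfiesGP_iff {n r : ℕ} {u : Sub n r → Trop} :
    SatisfiesGP u ↔ Exchange (coord u) (coord u) := by
  constructor
  · intro h I J i hi hiJ hfin
    have hI := card_of_coord_ne_top (WithTop.add_ne_top.1 hfin).1
    have hJ := card_of_coord_ne_top (WithTop.add_ne_top.1 hfin).2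
    have h1 : insert i (I.erase i) = I := Finset.insert_erase hi
    have h2 : (insert i J).erase i = J := Finset.erase_insert hiJ
    by_cases hIJ : (I ∩ J).card + 1 < r
    · obtain ⟨j, hj, hji, hle⟩ := minTwice_iff.1 (h I J hI hJ hIJ i (by simp [hi, hiJ]))
        i (by simp) (by rwa [h1, h2])
      rw [h1, h2, Finset.erase_insert_of_ne hji.symm] at hle
      refine ⟨j, ?_, ?_, hle⟩ <;> clear * - hj hji <;> grind
    · have c1 := Finset.card_sdiff_add_card_inter I J
      have c2 := Finset.card_sdiff_add_card_inter J I
      rw [Finset.inter_comm J I] at c2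
      have hpos : 0 < (I \ J).card := Finset.card_pos.2 ⟨i, by simp [hi, hiJ]⟩
      exact exchange_of_card_sdiff_eq_one _ (by omega) (by omega) hi hiJ
  · intro h I J hI hJ hIJ i hi
    rw [Finset.mem_sdiff] at hi
    have := satisfiesIP_iff.2 h (I.erase i) (insert i J)
      (by rw [Finset.card_erase_add_one hi.1, hI])
      (by rw [Finset.card_insert_of_notMem hi.2, hJ])
    rwa [show insert i J \ I.erase i = insert i (J \ I) by clear * - hi; ext x; grind] at this

/-! ### Exchange at distance two implies exchange -/

theorem add_ne_top_of_le {a b c d : Trop} (ha : a ≠ ⊤) (hb : b ≠ ⊤) (h : c + d ≤ a + b) :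
    c + d ≠ ⊤ :=
  ne_top_of_le_ne_top (WithTop.add_ne_top.2 ⟨ha, hb⟩) h

theorem exists_real_between {a b c d : Trop} (ha : a ≠ ⊤) (hb : b ≠ ⊤) (h : a + b < c + d) :
    ∃ p : ℝ, a ≤ c + p ∧ b + p < d := by
  lift a to ℝ using ha
  lift b to ℝ using hb
  rcases eq_or_ne c ⊤ with rfl | hc
  · rcases eq_or_ne d ⊤ with rfl | hd
    · exact ⟨0, by simp, by simp⟩
    · lift d to ℝ using hd
      refine ⟨d - b - 1, by simp, ?_⟩
      rw [← WithTop.coe_add, WithTop.coe_lt_coe]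
      linarith
  · lift c to ℝ using hc
    refine ⟨a - c, by rw [← WithTop.coe_add]; simp, ?_⟩
    rcases eq_or_ne d ⊤ with rfl | hd
    · exact WithTop.coe_lt_top (b + (a - c))
    · lift d to ℝ using hd
      norm_cast at h ⊢
      linarith

/-- The arithmetic behind `exchange_of_local`. There the values are `y = f J`,
`z = f (J + a - c)`, `s = f (J + a - c + i - j)`, `t = f (J + i - j)`, `v = f (J + a - j)` and
`w = f (J + i - c)`, with weights `p` at `j` and `q` at `c`; the hypothesis `h` is the exchange of
`i` between `J + a - c + i - j` and `J`. -/
theorem add_lt_of_local {y z s t v w : Trop} {p q : ℝ} (hy : y ≠ ⊤) (hz : z ≠ ⊤)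
    (ht : y + p < t) (hw : y + q < w) (hv : z + p ≤ v + q)
    (h : y + s ≠ ⊤ → z + t ≤ y + s ∨ v + w ≤ y + s) : z + p < s := by
  lift y to ℝ using hy
  lift z to ℝ using hz
  rcases eq_or_ne s ⊤ with rfl | hs
  · simp [← WithTop.coe_add]
  lift s to ℝ using hs
  rcases h (by simp [← WithTop.coe_add]) with h | h
  · have : t ≠ ⊤ := by rintro rfl; simp [← WithTop.coe_add] at h
    lift t to ℝ using this
    norm_cast at *
    linarith
  · have h1 : v ≠ ⊤ := by rintro rfl; simp [← WithTop.coe_add] at h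
    have h2 : w ≠ ⊤ := by rintro rfl; simp [← WithTop.coe_add] at h
    lift v to ℝ using h1
    lift w to ℝ using h2
    norm_cast at *
    linarith

/-- Exchange for pairs `I`, `J` at distance two implies exchange for all pairs, provided that
`J` can always be moved towards `I` by a finite-valued exchange that brings in an element of
`I \ J` other than a prescribed `i`. In a violating pair `(I, J)`, moving `J` so as to minimize
a suitably weighted value yields a violating pair at smaller distance. -/
theorem exchange_of_local {α : Type} [DecidableEq α] {f : Finset α → Trop}
    (hcard : ∀ I J, f I ≠ ⊤ → f J ≠ ⊤ → I.card = J.card)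
    (hloc : ∀ I J, (I \ J).card = 2 → ∀ i ∈ I, i ∉ J → f I + f J ≠ ⊤ →
      ∃ j ∈ J, j ∉ I ∧ f (insert j (I.erase i)) + f (insert i (J.erase j)) ≤ f I + f J)
    (hsupp : ∀ I J, 2 < (I \ J).card → f I ≠ ⊤ → f J ≠ ⊤ → ∀ i ∈ I, i ∉ J →
      ∃ a ∈ I, a ∉ J ∧ a ≠ i ∧ ∃ b ∈ J, b ∉ I ∧ f (insert a (J.erase b)) ≠ ⊤) :
    Exchange f f := by
  suffices H : ∀ m I J, (I \ J).card = m → ∀ i ∈ I, i ∉ J → f I + f J ≠ ⊤ →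
      ∃ j ∈ J, j ∉ I ∧ f (insert j (I.erase i)) + f (insert i (J.erase j)) ≤ f I + f J from
    fun I J => H _ I J rfl
  intro m
  induction m with
  | zero => 
    intro I J hm i hi hiJ
    rw [Finset.card_eq_zero, Finset.sdiff_eq_empty_iff_subset] at hm
    exact absurd (hm hi) hiJ
  | succ m ih =>
    intro I J hm i hi hiJ hfin
    obtain ⟨hI, hJ⟩ := WithTop.add_ne_top.1 hfin
    have hIJ := hcard I J hI hJ
    have hm' : (J \ I).card = m + 1 := by
      rw [← hm]; exact (Finset.card_sdiff_comm hIJ).symm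
    rcases (by omega : m = 0 ∨ m = 1 ∨ 2 ≤ m) with rfl | rfl | hm2
    · exact exchange_of_card_sdiff_eq_one f hm hm' hi hiJ
    · exact hloc I J hm i hi hiJ hfin
    by_contra! hbad
    -- Real weights `p` distribute the strict gap of the violated exchange over the two summands.
    have hp : ∀ j, ∃ p : ℝ, j ∈ J → j ∉ I → f I ≤ f (insert j (I.erase i)) + p ∧
        f J + p < f (insert i (J.erase j)) := fun j => by
      by_cases hj : j ∈ J ∧ j ∉ I
      · obtain ⟨p, hp⟩ := exists_real_between hI hJ (hbad j hj.1 hj.2)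
        exact ⟨p, fun _ _ => hp⟩
      · exact ⟨0, fun h h' => absurd ⟨h, h'⟩ hj⟩
    choose p hp using hp
    obtain ⟨a, ha, haJ, hai, b, hb, hbI, hab⟩ := hsupp I J (by omega) hI hJ i hi hiJ
    -- Among the sets `J + a - j`, the weighted minimum is at `j = c`; the pair `(I, J + a - c)`
    -- is again violating, and closer.
    obtain ⟨c, hc, hmin⟩ := (J \ I).exists_min_image
      (fun j => f (insert a (J.erase j)) + ((-p j : ℝ) : Trop)) ⟨b, by simp [hb, hbI]⟩
    have hle : ∀ j ∈ J, j ∉ I →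
        f (insert a (J.erase c)) + p j ≤ f (insert a (J.erase j)) + p c := by
      intro j hj hjI
      have h := hmin j (by simp [hj, hjI])
      have h := add_le_add_left h ((p j + p c : ℝ) : Trop)
      rw [add_assoc, add_assoc, ← WithTop.coe_add, ← WithTop.coe_add] at h
      simpa using h
    obtain ⟨hcJ, hcI⟩ := Finset.mem_sdiff.1 hc
    have hJ' : f (insert a (J.erase c)) ≠ ⊤ := by
      intro h
      have := hle b hb hbI
      rw [h, WithTop.top_add, top_le_iff, WithTop.add_eq_top] at this
      simp [hab] at this
    have hcard' : (I \ insert a (J.erase c)).card = m := by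
      have : I \ insert a (J.erase c) = (I \ J).erase a := by
        clear * - hcI; ext x; grind
      rw [this, Finset.card_erase_of_mem (by simp [ha, haJ]), hm]
      simp
    obtain ⟨j, hj, hjI, hexch⟩ := ih I (insert a (J.erase c)) hcard' i hi
      (by clear * - hai hiJ; grind)
      (WithTop.add_ne_top.2 ⟨hI, hJ'⟩)
    have hjJ : j ∈ J := by clear * - hj hjI ha; grind
    have hjc : j ≠ c := by clear * - hj hjI ha; grind
    have key : f (insert a (J.erase c)) + p j < f (insert i ((insert a (J.erase c)).erase j)) := by
      refine add_lt_of_local hJ hJ' (hp j hjJ hjI).2 (hp c hcJ hcI).2 (hle j hjJ hjI) fun hfin' => ?_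
      rw [add_comm] at hfin'
      have hsd : insert i ((insert a (J.erase c)).erase j) \ J = {i, a} := by
        clear * - hiJ ha haJ hjI; ext x; grind
      obtain ⟨k, hk, hkI, h⟩ := hloc (insert i ((insert a (J.erase c)).erase j)) J
        (by rw [hsd, Finset.card_pair hai.symm]) i (by simp) hiJ hfin'
      rw [add_comm (f _) (f J)] at h
      have hk' : k = j ∨ k = c := by clear * - hk hkI; grind
      rcases hk' with rfl | rfl
      · left
        rwa [show insert k ((insert i ((insert a (J.erase c)).erase k)).erase i) =
          insert a (J.erase c) by
            clear * - hiJ hai hjJ hjc; ext x; grind] at h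
      · right
        rwa [show insert k ((insert i ((insert a (J.erase k)).erase j)).erase i) =
          insert a (J.erase j) by
            clear * - hiJ hai hcJ hjc haJ hjJ; ext x; grind] at h
    refine absurd hexch (not_le.2 ?_)
    have h1 := (hp j hjJ hjI).1
    generalize f (insert j (I.erase i)) = x at h1 ⊢
    generalize f (insert i ((insert a (J.erase c)).erase j)) = y at key ⊢
    generalize f (insert a (J.erase c)) = z at key hJ' ⊢
    clear hp hle hmin hexch
    generalize f I = w at h1 hI ⊢
    lift z to ℝ using hJ'
    lift w to ℝ using hI
    rcases eq_or_ne x ⊤ with rfl | hx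
    · simp [← WithTop.coe_add]
    rcases eq_or_ne y ⊤ with rfl | hy
    · simp [← WithTop.coe_add]
    lift x to ℝ using hx
    lift y to ℝ using hy
    norm_cast at *
    linarith

/-! ### Gluing the exchange properties of the two parts -/

/-- A subset of `{1, …, n}` as a subset of `{0, …, n}`. -/
def up {n : ℕ} (S : Finset (Fin n)) : Finset (Fin (n + 1)) := S.map (Fin.succEmb n)

/-- `S ∪ 0` for a subset `S` of `{1, …, n}`. -/
def cone {n : ℕ} (S : Finset (Fin n)) : Finset (Fin (n + 1)) := insert 0 (up S)

section SetLemmas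

variable {n : ℕ} {A B : Finset (Fin n)} {i j : Fin n}

@[simp] theorem zero_notMem_up : (0 : Fin (n + 1)) ∉ up A := by simp [up, Fin.succ_ne_zero]

@[simp] theorem succ_mem_up : i.succ ∈ up A ↔ i ∈ A := by simp [up]

@[simp] theorem zero_mem_cone : (0 : Fin (n + 1)) ∈ cone A := by simp [cone]

@[simp] theorem succ_mem_cone : i.succ ∈ cone A ↔ i ∈ A := by simp [cone, Fin.succ_ne_zero]

theorem ext_fin_succ {K L : Finset (Fin (n + 1))} (h0 : 0 ∈ K ↔ 0 ∈ L)
    (h : ∀ i : Fin n, i.succ ∈ K ↔ i.succ ∈ L) : K = L :=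
  Finset.ext fun x => Fin.cases h0 h x

theorem eq_cone_or_eq_up (K : Finset (Fin (n + 1))) :
    (0 ∈ K ∧ K = cone (dropZero K)) ∨ (0 ∉ K ∧ K = up (dropZero K)) := by
  by_cases h : 0 ∈ K
  · exact .inl ⟨h, ext_fin_succ (by simp [h]) (by simp [dropZero])⟩
  · exact .inr ⟨h, ext_fin_succ (by simp [h]) (by simp [dropZero])⟩

theorem card_up : (up A).card = A.card := Finset.card_map _

theorem card_cone : (cone A).card = A.card + 1 := by
  rw [cone, Finset.card_insert_of_notMem zero_notMem_up, card_up]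

theorem insert_succ_erase_succ_up :
    insert j.succ ((up A).erase i.succ) = up (insert j (A.erase i)) :=
  ext_fin_succ (by simp [(Fin.succ_ne_zero _).symm]) (by simp)

theorem insert_succ_erase_succ_cone :
    insert j.succ ((cone A).erase i.succ) = cone (insert j (A.erase i)) :=
  ext_fin_succ (by simp [(Fin.succ_ne_zero _).symm]) (by simp)

theorem insert_succ_erase_zero_cone :
    insert j.succ ((cone A).erase 0) = up (insert j A) :=
  ext_fin_succ (by simp [(Fin.succ_ne_zero _).symm]) (by simp [Fin.succ_ne_zero])

theorem insert_zero_erase_succ_up :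
    insert 0 ((up A).erase i.succ) = cone (A.erase i) :=
  ext_fin_succ (by simp) (by simp [Fin.succ_ne_zero])

theorem up_sdiff_up : up A \ up B = up (A \ B) := ext_fin_succ (by simp) (by simp)

theorem cone_sdiff_cone : cone A \ cone B = up (A \ B) := ext_fin_succ (by simp) (by simp)

theorem cone_sdiff_up : cone A \ up B = cone (A \ B) := ext_fin_succ (by simp) (by simp)

theorem up_sdiff_cone : up A \ cone B = up (A \ B) := ext_fin_succ (by simp) (by simp)

end SetLemmas

section Glue

variable {n : ℕ} {f : Finset (Fin (n + 1)) → Trop}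

theorem Exchange.comp_cone (h : Exchange f f) :
    Exchange (fun S => f (cone S)) (fun S => f (cone S)) := by
  intro I J i hi hiJ hfin
  obtain ⟨j, hj, hjI, hle⟩ := h (cone I) (cone J) i.succ (by simpa) (by simpa) hfin
  cases j using Fin.cases with
  | zero => simp at hjI
  | succ j =>
    rw [insert_succ_erase_succ_cone, insert_succ_erase_succ_cone] at hle
    exact ⟨j, by simpa using hj, by simpa using hjI, hle⟩

theorem Exchange.comp_up (h : Exchange f f) :
    Exchange (fun S => f (up S)) (fun S => f (up S)) := by
  intro I J i hi hiJ hfin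
  obtain ⟨j, hj, hjI, hle⟩ := h (up I) (up J) i.succ (by simpa) (by simpa) hfin
  cases j using Fin.cases with
  | zero => simp at hj
  | succ j =>
    rw [insert_succ_erase_succ_up, insert_succ_erase_succ_up] at hle
    exact ⟨j, by simpa using hj, by simpa using hjI, hle⟩

theorem Exchange.comp_cone_up (h : Exchange f f) :
    Exchange (fun S => f (cone S)) (fun S => f (up S)) := by
  intro I J i hi hiJ hfin
  obtain ⟨j, hj, hjI, hle⟩ := h (cone I) (up J) i.succ (by simpa) (by simpa) hfin
  cases j using Fin.cases with
  | zero => simp at hj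
  | succ j =>
    rw [insert_succ_erase_succ_cone, insert_succ_erase_succ_up] at hle
    exact ⟨j, by simpa using hj, by simpa using hjI, hle⟩

theorem exists_mem_ne_of_one_lt_card {α : Type} [DecidableEq α] {s : Finset α} {i : α}
    (h : 1 < s.card) : ∃ a ∈ s, a ≠ i := by
  obtain ⟨a, ha, b, hb, hab⟩ := Finset.one_lt_card.1 h
  by_cases hai : a = i
  · exact ⟨b, hb, fun h => hab (hai.trans h.symm)⟩
  · exact ⟨a, ha, hai⟩

theorem exists_mem_sdiff_succ_ne {A B : Finset (Fin n)} (h : 1 < (A \ B).card)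
    (i : Fin (n + 1)) : ∃ a ∈ A, a ∉ B ∧ a.succ ≠ i := by
  cases i using Fin.cases with
  | zero =>
    obtain ⟨a, ha⟩ := Finset.card_pos.1 (zero_lt_one.trans h)
    rw [Finset.mem_sdiff] at ha
    exact ⟨a, ha.1, ha.2, Fin.succ_ne_zero a⟩
  | succ i =>
    obtain ⟨a, ha, hai⟩ := exists_mem_ne_of_one_lt_card (i := i) h
    rw [Finset.mem_sdiff] at ha
    exact ⟨a, ha.1, ha.2, by simpa using hai⟩

theorem insert_erase_eq_of_sdiff_pair {α : Type} [DecidableEq α] {A B : Finset α} {a j k : α}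
    (hA : (A \ B).card = 1) (hB : (B \ A).card = 2) (haA : a ∈ A) (haB : a ∉ B)
    (hjB : j ∈ B) (hjA : j ∉ A) (hkB : k ∈ B) (hkA : k ∉ A) (hjk : j ≠ k) :
    insert j (A.erase a) = B.erase k ∧ insert a (B.erase j) = insert k A := by
  have h1 : A \ B = {a} := by
    obtain ⟨b, hb⟩ := Finset.card_eq_one.1 hA
    obtain rfl : a = b := Finset.mem_singleton.1 (hb ▸ Finset.mem_sdiff.2 ⟨haA, haB⟩)
    exact hb
  have h2 : {j, k} = B \ A := by
    refine Finset.eq_of_subset_of_card_le ?_ (by rw [Finset.card_pair hjk, hB])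
    intro x hx
    rw [Finset.mem_insert, Finset.mem_singleton] at hx
    rcases hx with rfl | rfl <;> simp [*]
  have h1 x := Finset.ext_iff.1 h1 x
  have h2 x := Finset.ext_iff.1 h2 x
  simp only [Finset.mem_sdiff, Finset.mem_singleton, Finset.mem_insert] at h1 h2
  constructor <;> ext x <;> simp only [Finset.mem_insert, Finset.mem_erase] <;>
    specialize h1 x <;> specialize h2 x <;> clear hA hB <;> grind

/-- The support condition of `exchange_of_local` for `I ∌ 0` and `J = C ∪ 0`, where `g` is the part
of the vector on sets containing `0` and `h` the part on the other sets. If a first exchange between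
`C` and `I` brings `i` into `C`, a second one brings in another element `a` of `I \ C`, and
exchanging `a` back between the resulting set and `C` brings `a` alone into `C`. -/
theorem exists_finite_exchange {α : Type} [DecidableEq α] {g h : Finset α → Trop}
    (hg : Exchange g g) (hgh : Exchange g h) {C I : Finset α} (hC : g C ≠ ⊤) (hI : h I ≠ ⊤)
    (hcard : 1 < (C \ I).card) (i : α) (hi : i ∈ I) (hiC : i ∉ C) :
    ∃ a ∈ I, a ∉ C ∧ a ≠ i ∧ ∃ b ∈ C, b ∉ I ∧ g (insert a (C.erase b)) ≠ ⊤ := by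
  obtain ⟨c, hc, d, hd, hcd⟩ := Finset.one_lt_card.1 hcard
  rw [Finset.mem_sdiff] at hc hd
  obtain ⟨j, hj, hjC, hle⟩ := hgh C I c hc.1 hc.2 (WithTop.add_ne_top.2 ⟨hC, hI⟩)
  have h1 := (WithTop.add_ne_top.1 (add_ne_top_of_le hC hI hle)).1
  by_cases hji : j ≠ i
  · exact ⟨j, hj, hjC, hji, c, hc.1, hc.2, h1⟩
  obtain rfl := not_not.1 hji
  obtain ⟨a, ha, haC, hle⟩ := hgh (insert j (C.erase c)) I d
    (by simp [hd.1, hcd.symm]) hd.2 (WithTop.add_ne_top.2 ⟨h1, hI⟩)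
  have h2 := (WithTop.add_ne_top.1 (add_ne_top_of_le h1 hI hle)).1
  have haj : a ≠ j := by rintro rfl; simp at haC
  have hac : a ≠ c := by rintro rfl; exact hc.2 ha
  have haC' : a ∉ C := by simp_all
  obtain ⟨b, hb, hbC, hle⟩ := hg _ C a (Finset.mem_insert_self _ _) haC'
    (WithTop.add_ne_top.2 ⟨h2, hC⟩)
  refine ⟨a, ha, haC', haj, b, hb, ?_, (WithTop.add_ne_top.1 (add_ne_top_of_le h2 hC hle)).2⟩
  have hbcd : b = c ∨ b = d := by clear * - hb hbC hcd; grind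
  rcases hbcd with rfl | rfl
  exacts [hc.2, hd.2]

/-- The mixed relations for `I ∌ 0`, `J ∋ 0` need not be assumed. At distance two they are
instances of the relations for `I ∋ 0`, `J ∌ 0`, since both types have the same three terms there;
`exchange_of_local` extends them to all distances. -/
theorem exchange_of_cone_up
    (hcard : ∀ I J, f I ≠ ⊤ → f J ≠ ⊤ → I.card = J.card)
    (hcc : Exchange (fun S => f (cone S)) (fun S => f (cone S)))
    (huu : Exchange (fun S => f (up S)) (fun S => f (up S)))
    (hcu : Exchange (fun S => f (cone S)) (fun S => f (up S))) : Exchange f f := by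
  apply exchange_of_local hcard
  · intro I J hIJ i hi hiJ hfin
    have hJI : (J \ I).card = 2 := by
      rw [Finset.card_sdiff_comm, hIJ]
      exact hcard J I (WithTop.add_ne_top.1 hfin).2 (WithTop.add_ne_top.1 hfin).1
    rcases eq_cone_or_eq_up I with ⟨-, hI⟩ | ⟨-, hI⟩ <;>
    rcases eq_cone_or_eq_up J with ⟨-, hJ⟩ | ⟨-, hJ⟩ <;>
    generalize dropZero I = A at hI <;> generalize dropZero J = B at hJ <;> subst hI hJ
    · cases i using Fin.cases with
      | zero => simp at hiJ
      | succ i =>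
        obtain ⟨j, hj, hjA, hle⟩ := hcc A B i (by simpa using hi) (by simpa using hiJ) hfin
        refine ⟨j.succ, by simpa, by simpa, ?_⟩
        rwa [insert_succ_erase_succ_cone, insert_succ_erase_succ_cone]
    · cases i using Fin.cases with
      | zero =>
        rw [cone_sdiff_up, card_cone] at hIJ
        rw [up_sdiff_cone, card_up] at hJI
        -- The exchange of `a` for `j` is, up to the order of the summands, that of `0` for `k`.
        obtain ⟨a, ha⟩ := Finset.card_eq_one.1 (by omega : (A \ B).card = 1)
        obtain ⟨haA, haB⟩ := Finset.mem_sdiff.1 (ha ▸ Finset.mem_singleton_self a)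
        obtain ⟨j, hj, hjA, hle⟩ := hcu A B a haA haB hfin
        obtain ⟨k, hk, hkj⟩ := exists_mem_ne_of_one_lt_card (i := j) (by omega : 1 < (B \ A).card)
        obtain ⟨hkB, hkA⟩ := Finset.mem_sdiff.1 hk
        obtain ⟨e1, e2⟩ := insert_erase_eq_of_sdiff_pair (by omega) hJI haA haB hj hjA hkB hkA
          hkj.symm
        rw [e1, e2, add_comm] at hle
        refine ⟨k.succ, by simpa, by simpa, ?_⟩
        rwa [insert_succ_erase_zero_cone, insert_zero_erase_succ_up]
      | succ i =>
        obtain ⟨j, hj, hjA, hle⟩ := hcu A B i (by simpa using hi) (by simpa using hiJ) hfin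
        refine ⟨j.succ, by simpa, by simpa, ?_⟩
        rwa [insert_succ_erase_succ_cone, insert_succ_erase_succ_up]
    · cases i using Fin.cases with
      | zero => simp at hi
      | succ i =>
        rw [succ_mem_up] at hi
        rw [succ_mem_cone] at hiJ
        rw [up_sdiff_cone, card_up] at hIJ
        rw [cone_sdiff_up, card_cone] at hJI
        obtain ⟨c, hc⟩ := Finset.card_pos.1 (by omega : 0 < (B \ A).card)
        obtain ⟨hcB, hcA⟩ := Finset.mem_sdiff.1 hc
        rw [add_comm] at hfin
        obtain ⟨j, hj, hjB, hle⟩ := hcu B A c hcB hcA hfin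
        rw [add_comm (f (cone B))] at hle
        -- The exchange of `c` for `j` is that of `i` for `c` if `j = i`, and of `i` for `0` if not.
        by_cases hji : j = i
        · subst hji
          refine ⟨c.succ, by simpa, by simpa, ?_⟩
          rwa [insert_succ_erase_succ_cone, insert_succ_erase_succ_up, add_comm]
        · obtain ⟨e1, e2⟩ := insert_erase_eq_of_sdiff_pair (by omega) hIJ hcB hcA hj hjB hi hiJ hji
          rw [e1, e2] at hle
          refine ⟨0, by simp, by simp, ?_⟩
          rwa [insert_succ_erase_zero_cone, insert_zero_erase_succ_up]
    · cases i using Fin.cases with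
      | zero => simp at hi
      | succ i =>
        obtain ⟨j, hj, hjA, hle⟩ := huu A B i (by simpa using hi) (by simpa using hiJ) hfin
        refine ⟨j.succ, by simpa, by simpa, ?_⟩
        rwa [insert_succ_erase_succ_up, insert_succ_erase_succ_up]
  · intro I J hIJ hfI hfJ i hi hiJ
    have hJI : 2 < (J \ I).card := by
      rwa [Finset.card_sdiff_comm (hcard J I hfJ hfI)]
    rcases eq_cone_or_eq_up I with ⟨-, hI⟩ | ⟨-, hI⟩ <;>
    rcases eq_cone_or_eq_up J with ⟨-, hJ⟩ | ⟨-, hJ⟩ <;>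
    generalize dropZero I = A at hI <;> generalize dropZero J = B at hJ <;> subst hI hJ
    · rw [cone_sdiff_cone, card_up] at hIJ
      obtain ⟨a, ha, haB, hai⟩ := exists_mem_sdiff_succ_ne (B := B) (A := A) (by omega) i
      obtain ⟨b, hb, hbA, hle⟩ := hcc A B a ha haB (WithTop.add_ne_top.2 ⟨hfI, hfJ⟩)
      refine ⟨a.succ, by simpa, by simpa, hai, b.succ, by simpa, by simpa, ?_⟩
      rw [insert_succ_erase_succ_cone]
      exact (WithTop.add_ne_top.1 (add_ne_top_of_le hfI hfJ hle)).2
    · rw [cone_sdiff_up, card_cone] at hIJ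
      obtain ⟨a, ha, haB, hai⟩ := exists_mem_sdiff_succ_ne (B := B) (A := A) (by omega) i
      obtain ⟨b, hb, hbA, hle⟩ := hcu A B a ha haB (WithTop.add_ne_top.2 ⟨hfI, hfJ⟩)
      refine ⟨a.succ, by simpa, by simpa, hai, b.succ, by simpa, by simpa, ?_⟩
      rw [insert_succ_erase_succ_up]
      exact (WithTop.add_ne_top.1 (add_ne_top_of_le hfI hfJ hle)).2
    · cases i using Fin.cases with
      | zero => simp at hi
      | succ i =>
        rw [cone_sdiff_up, card_cone] at hJI
        obtain ⟨a, ha, haB, hai, b, hb, hbA, h⟩ := exists_finite_exchange hcc hcu hfJ hfI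
          (by omega) i (by simpa using hi) (by simpa using hiJ)
        refine ⟨a.succ, by simpa, by simpa, by simpa, b.succ, by simpa, by simpa, ?_⟩
        rwa [insert_succ_erase_succ_cone]
    · rw [up_sdiff_up, card_up] at hIJ
      obtain ⟨a, ha, haB, hai⟩ := exists_mem_sdiff_succ_ne (B := B) (A := A) (by omega) i
      obtain ⟨b, hb, hbA, hle⟩ := huu A B a ha haB (WithTop.add_ne_top.2 ⟨hfI, hfJ⟩)
      refine ⟨a.succ, by simpa, by simpa, hai, b.succ, by simpa, by simpa, ?_⟩
      rw [insert_succ_erase_succ_up]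
      exact (WithTop.add_ne_top.1 (add_ne_top_of_le hfI hfJ hle)).2

end Glue

/-! ### Splitting off the element `0` -/

theorem Exchange.add_const {α : Type} [DecidableEq α] {f g f' g' : Finset α → Trop}
    (h : Exchange f g) {c d : ℝ} (hf : ∀ S, f' S = f S + c) (hg : ∀ S, g' S = g S + d) :
    Exchange f' g' := by
  intro I J i hi hiJ hfin
  simp only [hf, hg] at hfin ⊢
  obtain ⟨j, hj, hjI, hle⟩ := h I J i hi hiJ (by simpa using hfin)
  refine ⟨j, hj, hjI, ?_⟩
  rw [add_add_add_comm, add_add_add_comm (f I)]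
  gcongr

theorem coord_add_const {n r : ℕ} {u v : Sub n r → Trop} {c : ℝ} (h : ∀ e, v e = u e + c)
    (S : Finset (Fin n)) : coord v S = coord u S + c := by
  unfold coord
  split_ifs
  · exact h _
  · simp

section Split

variable {n r : ℕ} {A : Type}

theorem coord_cone (u : Sub (n + 1) (r + 1) → Trop) (S : Finset (Fin n)) :
    coord u (cone S) = coord (split u).1 S := by
  by_cases h : S.card = r
  · rw [coord, coord, dif_pos h, dif_pos (by rw [card_cone, h])]
    rfl
  · rw [coord, coord, dif_neg h, dif_neg (by rw [card_cone]; omega)]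

theorem coord_up (u : Sub (n + 1) (r + 1) → Trop) (S : Finset (Fin n)) :
    coord u (up S) = coord (split u).2 S := by
  by_cases h : S.card = r + 1
  · rw [coord, coord, dif_pos h, dif_pos (by rw [card_up, h])]
    rfl
  · rw [coord, coord, dif_neg h, dif_neg (by rw [card_up]; omega)]

theorem exists_withZero_or_withoutZero (K : Sub (n + 1) (r + 1)) :
    (0 ∈ K.1 ∧ ∃ I : Sub n r, K = withZero I) ∨
      (0 ∉ K.1 ∧ ∃ J : Sub n (r + 1), K = withoutZero J) := by
  rcases eq_cone_or_eq_up K.1 with ⟨h0, h⟩ | ⟨h0, h⟩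
  · have := K.2
    rw [h, card_cone] at this
    exact .inl ⟨h0, ⟨dropZero K.1, by omega⟩, Subtype.ext h⟩
  · have := K.2
    rw [h, card_up] at this
    exact .inr ⟨h0, ⟨dropZero K.1, this⟩, Subtype.ext h⟩

theorem split_ext {u v : Sub (n + 1) (r + 1) → A} (h1 : ∀ I, (split u).1 I = (split v).1 I)
    (h2 : ∀ J, (split u).2 J = (split v).2 J) : u = v := by
  funext K
  rcases exists_withZero_or_withoutZero K with ⟨-, I, rfl⟩ | ⟨-, J, rfl⟩
  exacts [h1 I, h2 J]

theorem split_bijective : Function.Bijective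
    (split : (Sub (n + 1) (r + 1) → A) → (Sub n r → A) × (Sub n (r + 1) → A)) := by
  constructor
  · intro u v h
    exact split_ext (congrFun (congrArg Prod.fst h)) (congrFun (congrArg Prod.snd h))
  · rintro ⟨f, g⟩
    have hz : ∀ K : Sub (n + 1) (r + 1), ∃ a : A,
        (∀ I, K = withZero I → a = f I) ∧ (∀ J, K = withoutZero J → a = g J) := by
      intro K
      rcases exists_withZero_or_withoutZero K with ⟨h0, I, rfl⟩ | ⟨h0, J, rfl⟩
      · refine ⟨f I, fun I' h => ?_, fun J h => ?_⟩
        · rw [Subtype.ext (dropZero_withZero I ▸ dropZero_withZero I' ▸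
            congrArg (fun K => dropZero K.1) h : I.1 = I'.1)]
        · rw [h] at h0
          exact absurd h0 (zero_notMem_up (A := J.1))
      · refine ⟨g J, fun I h => ?_, fun J' h => ?_⟩
        · rw [h] at h0
          exact absurd (zero_mem_cone (A := I.1)) h0
        · rw [Subtype.ext (dropZero_withoutZero J ▸ dropZero_withoutZero J' ▸
            congrArg (fun K => dropZero K.1) h : J.1 = J'.1)]
    choose u hu hu' using hz
    exact ⟨u, Prod.ext (funext fun I => hu _ I rfl) (funext fun J => hu' _ J rfl)⟩

/-- A vector satisfies the Grassmann-Plücker relations if and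
only if its two parts do and satisfy the incidence relations. -/
theorem satisfiesGP_iff_split {u : Sub (n + 1) (r + 1) → Trop} :
    SatisfiesGP u ↔
      SatisfiesGP (split u).1 ∧ SatisfiesGP (split u).2 ∧ SatisfiesIP (split u).1 (split u).2 := by
  have h1 : (fun S => coord u (cone S)) = coord (split u).1 := funext (coord_cone u)
  have h2 : (fun S => coord u (up S)) = coord (split u).2 := funext (coord_up u)
  rw [satisfiesGP_iff, satisfiesGP_iff, satisfiesGP_iff, satisfiesIP_iff, ← h1, ← h2]
  refine ⟨fun h => ⟨h.comp_cone, h.comp_up, h.comp_cone_up⟩, fun h => ?_⟩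
  exact exchange_of_cone_up
    (fun I J hI hJ => (card_of_coord_ne_top hI).trans (card_of_coord_ne_top hJ).symm) h.1 h.2.1 h.2.2

end Split

theorem TropProj.mk_eq_mk {E : Type} {u v : TropVec E} :
    TropProj.mk u = TropProj.mk v ↔ ∃ c : ℝ, ∀ e, v.1 e = u.1 e + c :=
  Quotient.eq (r := TropVec.setoid E)

/-! ### The Dressians and the fiber points in projective space -/

section Projective

variable {n r s : ℕ}

theorem satisfiesGP_of_mk_eq {u v : TropVec (Sub n r)} (h : TropProj.mk u = TropProj.mk v)
    (hu : SatisfiesGP u.1) : SatisfiesGP v.1 := by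
  obtain ⟨c, hc⟩ := TropProj.mk_eq_mk.1 h
  rw [satisfiesGP_iff] at hu ⊢
  exact hu.add_const (coord_add_const hc) (coord_add_const hc)

theorem satisfiesIP_of_mk_eq {u u' : TropVec (Sub n r)} {v v' : TropVec (Sub n s)}
    (h : TropProj.mk u = TropProj.mk u') (h' : TropProj.mk v = TropProj.mk v')
    (huv : SatisfiesIP u.1 v.1) : SatisfiesIP u'.1 v'.1 := by
  obtain ⟨c, hc⟩ := TropProj.mk_eq_mk.1 h
  obtain ⟨d, hd⟩ := TropProj.mk_eq_mk.1 h'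
  rw [satisfiesIP_iff] at huv ⊢
  exact huv.add_const (coord_add_const hc) (coord_add_const hd)

theorem mk_mem_Dr_iff {u : TropVec (Sub n r)} : TropProj.mk u ∈ Dr r n ↔ SatisfiesGP u.1 :=
  ⟨fun ⟨_, h, hv⟩ => satisfiesGP_of_mk_eq h hv, fun h => ⟨u, rfl, h⟩⟩

theorem mk_mem_FlDr_iff {u : TropVec (Sub n r)} {v : TropVec (Sub n s)} :
    (TropProj.mk u, TropProj.mk v) ∈ FlDr r s n ↔
      SatisfiesGP u.1 ∧ SatisfiesGP v.1 ∧ SatisfiesIP u.1 v.1 := by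
  refine ⟨?_, fun h => ⟨u, v, rfl, h⟩⟩
  rintro ⟨u', v', h, h1, h2, h3⟩
  rw [Prod.mk.injEq] at h
  exact ⟨satisfiesGP_of_mk_eq h.1 h1, satisfiesGP_of_mk_eq h.2 h2, satisfiesIP_of_mk_eq h.1 h.2 h3⟩

theorem mk_mem_Omega_iff {u : TropVec (Sub (n + 1) (r + 1))} :
    TropProj.mk u ∈ Omega r n ↔ (∃ I, (split u.1).1 I ≠ ⊤) ∧ ∃ J, (split u.1).2 J ≠ ⊤ := by
  constructor
  · rintro ⟨v, h, ⟨K, hK, hK'⟩, L, hL, hL'⟩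
    obtain ⟨c, hc⟩ := TropProj.mk_eq_mk.1 h
    constructor
    · rcases exists_withZero_or_withoutZero K with ⟨-, I, rfl⟩ | ⟨h0, -⟩
      · exact ⟨I, by simpa [split, hc] using hK'⟩
      · exact absurd hK h0
    · rcases exists_withZero_or_withoutZero L with ⟨h0, -⟩ | ⟨-, J, rfl⟩
      · exact absurd h0 hL
      · exact ⟨J, by simpa [split, hc] using hL'⟩
  · rintro ⟨⟨I, hI⟩, J, hJ⟩
    exact ⟨u, rfl, ⟨withZero I, zero_mem_cone, hI⟩, ⟨withoutZero J, zero_notMem_up, hJ⟩⟩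

/-- The vector `a ⊙ μ' ⊕ b ⊙ μ`. -/
def fiberVec (μ' : TropVec (Sub n r)) (μ : TropVec (Sub n (r + 1))) (a b : ℝ) :
    TropVec (Sub (n + 1) (r + 1)) :=
  ((extendWith μ').scale a).oplus ((extendWithout μ).scale b)

variable (μ' : TropVec (Sub n r)) (μ : TropVec (Sub n (r + 1))) (a b : ℝ)

theorem fiberVec_withZero (I : Sub n r) : (fiberVec μ' μ a b).1 (withZero I) = a + μ'.1 I := by
  have h0 : 0 ∈ (withZero I).1 := zero_mem_cone
  simp only [fiberVec, TropVec.oplus, TropVec.scale, extendWith, extendWithout, if_pos h0,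
    dropZero_withZero]
  simp [coord, I.2]

theorem fiberVec_withoutZero (J : Sub n (r + 1)) :
    (fiberVec μ' μ a b).1 (withoutZero J) = b + μ.1 J := by
  have h0 : 0 ∉ (withoutZero J).1 := zero_notMem_up
  simp only [fiberVec, TropVec.oplus, TropVec.scale, extendWith, extendWithout, if_neg h0,
    dropZero_withoutZero]
  simp [coord, J.2]

theorem fiberPoint_eq_mk : fiberPoint μ' μ a b = TropProj.mk (fiberVec μ' μ a b) := rfl

theorem fiberPoint_sub_zero : fiberPoint μ' μ (a - b) 0 = fiberPoint μ' μ a b := by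
  refine TropProj.mk_eq_mk.2 ⟨b, fun K => ?_⟩
  change (fiberVec μ' μ a b).1 K = (fiberVec μ' μ (a - b) 0).1 K + b
  rcases exists_withZero_or_withoutZero K with ⟨-, I, rfl⟩ | ⟨-, J, rfl⟩
  · rw [fiberVec_withZero, fiberVec_withZero, add_right_comm, ← WithTop.coe_add, sub_add_cancel]
  · rw [fiberVec_withoutZero, fiberVec_withoutZero, WithTop.coe_zero, zero_add, add_comm]

theorem mk_split_fiberVec_fst (h : ∃ I, (split (fiberVec μ' μ a b).1).1 I ≠ ⊤) :
    TropProj.mk ⟨_, h⟩ = TropProj.mk μ' :=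
  (TropProj.mk_eq_mk.2 ⟨a, fun I => (fiberVec_withZero μ' μ a b I).trans (add_comm _ _)⟩).symm

theorem mk_split_fiberVec_snd (h : ∃ J, (split (fiberVec μ' μ a b).1).2 J ≠ ⊤) :
    TropProj.mk ⟨_, h⟩ = TropProj.mk μ :=
  (TropProj.mk_eq_mk.2 ⟨b, fun J => (fiberVec_withoutZero μ' μ a b J).trans (add_comm _ _)⟩).symm

theorem fiberPoint_mem_Omega : fiberPoint μ' μ a b ∈ Omega r n := by
  obtain ⟨I, hI⟩ := μ'.2
  obtain ⟨J, hJ⟩ := μ.2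
  rw [fiberPoint_eq_mk, mk_mem_Omega_iff]
  refine ⟨⟨I, ?_⟩, J, ?_⟩
  · simpa [split, fiberVec_withZero] using hI
  · simpa [split, fiberVec_withoutZero] using hJ

theorem eq_fiberPoint {u : TropVec (Sub (n + 1) (r + 1))} {h' : ∃ I, (split u.1).1 I ≠ ⊤}
    {h : ∃ J, (split u.1).2 J ≠ ⊤} (e' : TropProj.mk ⟨(split u.1).1, h'⟩ = TropProj.mk μ')
    (e : TropProj.mk ⟨(split u.1).2, h⟩ = TropProj.mk μ) :
    ∃ a b : ℝ, TropProj.mk u = fiberPoint μ' μ a b := by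
  obtain ⟨a, ha⟩ := TropProj.mk_eq_mk.1 e'.symm
  obtain ⟨b, hb⟩ := TropProj.mk_eq_mk.1 e.symm
  refine ⟨a, b, congrArg TropProj.mk (Subtype.ext (split_ext (fun I => ?_) fun J => ?_))⟩
  · exact (ha I).trans ((add_comm _ _).trans (fiberVec_withZero μ' μ a b I).symm)
  · exact (hb J).trans ((add_comm _ _).trans (fiberVec_withoutZero μ' μ a b J).symm)

end Projective

/-! ### Topology of the fiber -/

open Topology in
theorem TropProj.isQuotientMap_mk {E : Type} : IsQuotientMap (TropProj.mk : TropVec E → _) :=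
  isQuotientMap_quotient_mk'

/-- The difference of the coordinates `d` and `e` of a point. It does not depend on the
representative if both coordinates are finite, and is a junk value otherwise. -/
noncomputable def coordDiff {E : Type} (d e : E) (p : TropProj E) : ℝ :=
  ((Quotient.out p).1 d).untopD 0 - ((Quotient.out p).1 e).untopD 0

theorem coordDiff_mk {E : Type} {d e : E} {u : TropVec E} (hd : u.1 d ≠ ⊤) (he : u.1 e ≠ ⊤) :
    coordDiff d e (TropProj.mk u) = (u.1 d).untopD 0 - (u.1 e).untopD 0 := by
  have h : TropProj.mk u = TropProj.mk (Quotient.out (TropProj.mk u)) :=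
    (Quotient.out_eq (TropProj.mk u)).symm
  obtain ⟨c, hc⟩ := TropProj.mk_eq_mk.1 h
  rw [coordDiff, hc, hc]
  generalize u.1 d = x at hd ⊢
  generalize u.1 e = y at he ⊢
  lift x to ℝ using hd
  lift y to ℝ using he
  rw [← WithTop.coe_add, ← WithTop.coe_add]
  simp

/-- The points whose coordinates `d` and `e` are finite. -/
def finiteAt {E : Type} (d e : E) : Set (TropProj E) :=
  TropProj.mk '' {u | u.1 d ≠ ⊤ ∧ u.1 e ≠ ⊤}

theorem preimage_finiteAt {E : Type} (d e : E) :
    TropProj.mk ⁻¹' finiteAt d e = {u | u.1 d ≠ ⊤ ∧ u.1 e ≠ ⊤} := by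
  refine Set.Subset.antisymm ?_ (Set.subset_preimage_image _ _)
  rintro u ⟨v, hv, h⟩
  obtain ⟨c, hc⟩ := TropProj.mk_eq_mk.1 h
  simpa [hc] using hv

theorem continuousOn_coordDiff {E : Type} (d e : E) :
    ContinuousOn (coordDiff d e) (finiteAt d e) := by
  have hcont : ∀ e : E, Continuous fun u : TropVec E => u.1 e := fun e =>
    (continuous_apply e).comp continuous_subtype_val
  have hopen : IsOpen (finiteAt d e) := by
    rw [← TropProj.isQuotientMap_mk.isOpen_preimage, preimage_finiteAt]
    exact ((isOpen_ne (x := (⊤ : Trop))).preimage (hcont d)).inter (isOpen_ne.preimage (hcont e))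
  rw [TropProj.isQuotientMap_mk.continuousOn_isOpen_iff hopen, preimage_finiteAt]
  refine ContinuousOn.congr ?_ fun u hu => coordDiff_mk hu.1 hu.2
  exact ((WithTop.continuousOn_untopD 0).comp (hcont d).continuousOn fun u hu => hu.1).sub
    ((WithTop.continuousOn_untopD 0).comp (hcont e).continuousOn fun u hu => hu.2)

section Fiber

variable {n r : ℕ} (μ' : TropVec (Sub n r)) (μ : TropVec (Sub n (r + 1)))

theorem continuous_fiberPoint : Continuous fun t : ℝ => fiberPoint μ' μ t 0 := by
  refine TropProj.isQuotientMap_mk.continuous.comp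
    (Continuous.subtype_mk (continuous_pi fun K => ?_) _)
  change Continuous fun t : ℝ => (fiberVec μ' μ t 0).1 K
  rcases exists_withZero_or_withoutZero K with ⟨-, I, rfl⟩ | ⟨-, J, rfl⟩
  · simp only [fiberVec_withZero]
    rcases eq_or_ne (μ'.1 I) ⊤ with h | h
    · simp only [h, add_top]
      exact continuous_const
    · lift μ'.1 I to ℝ using h with x
      exact WithTop.continuous_coe.comp (continuous_id.add continuous_const)
  · simp only [fiberVec_withoutZero]
    exact continuous_const

/-- The classes `a ⊙ μ' ⊕ b ⊙ μ` are parametrized by `a - b`: one coordinate at which `μ'` is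
finite and one at which `μ` is finite suffice to recover `a - b`. -/
theorem exists_homeomorph_of_image_eq {S : Set (TropProj (Sub (n + 1) (r + 1)))} {F : Set S}
    (hF : Subtype.val '' F = {p | ∃ a b : ℝ, p = fiberPoint μ' μ a b}) :
    ∃ Ψ : F ≃ₜ ℝ, ∀ t, (Ψ.symm t).1.1 = fiberPoint μ' μ t 0 := by
  obtain ⟨I, hI⟩ := μ'.2
  obtain ⟨J, hJ⟩ := μ.2
  have hmem : ∀ t, ∃ h : fiberPoint μ' μ t 0 ∈ S, (⟨_, h⟩ : S) ∈ F := fun t => by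
    obtain ⟨p, hp, h⟩ : fiberPoint μ' μ t 0 ∈ Subtype.val '' F := hF ▸ ⟨t, 0, rfl⟩
    exact ⟨h ▸ p.2, by convert hp; exact h.symm⟩
  choose hS hmem using hmem
  have hform : ∀ p : F, ∃ t, p.1.1 = fiberPoint μ' μ t 0 := fun p => by
    obtain ⟨a, b, h⟩ : p.1.1 ∈ {p | ∃ a b : ℝ, p = fiberPoint μ' μ a b} :=
      hF ▸ Set.mem_image_of_mem _ p.2
    exact ⟨a - b, h.trans (fiberPoint_sub_zero μ' μ a b).symm⟩
  let g : F → ℝ := fun p => coordDiff (withZero I) (withoutZero J) p.1.1 -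
    ((μ'.1 I).untopD 0 - (μ.1 J).untopD 0)
  have hfin : ∀ t, (fiberVec μ' μ t 0).1 (withZero I) ≠ ⊤ ∧
      (fiberVec μ' μ t 0).1 (withoutZero J) ≠ ⊤ := fun t => by
    rw [fiberVec_withZero, fiberVec_withoutZero]
    simp [hI, hJ]
  have hg : ∀ (p : F) t, p.1.1 = fiberPoint μ' μ t 0 → g p = t := fun p t h => by
    simp only [g]
    rw [h, fiberPoint_eq_mk, coordDiff_mk (hfin t).1 (hfin t).2, fiberVec_withZero,
      fiberVec_withoutZero]
    lift μ'.1 I to ℝ using hI with x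
    lift μ.1 J to ℝ using hJ with y
    rw [← WithTop.coe_add, ← WithTop.coe_add]
    simp
  refine ⟨⟨⟨g, fun t => ⟨⟨_, hS t⟩, hmem t⟩, fun p => ?_, fun t => hg _ t rfl⟩, ?_, ?_⟩,
    fun t => rfl⟩
  · obtain ⟨t, ht⟩ := hform p
    exact Subtype.ext (Subtype.ext (by rw [hg p t ht, ht]))
  · refine Continuous.sub ?_ continuous_const
    refine (continuousOn_coordDiff (withZero I) (withoutZero J)).comp_continuous
      (continuous_subtype_val.comp continuous_subtype_val) fun p => ?_
    obtain ⟨t, ht⟩ := hform p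
    exact ⟨fiberVec μ' μ t 0, hfin t, ht.symm⟩
  · exact ((continuous_fiberPoint μ' μ).subtype_mk _).subtype_mk _

end Fiber

/-- The homeomorphism `(a, b) ↦ a - b` of `ℝ² / ℝ(1, 1)` onto `ℝ`. -/
noncomputable def quotientDiagonalHomeomorph :
    ((ℝ × ℝ) ⧸ Submodule.span ℝ {((1 : ℝ), (1 : ℝ))}) ≃ₜ ℝ where
  toFun := (Submodule.span ℝ {((1 : ℝ), (1 : ℝ))}).liftQ
    (LinearMap.fst ℝ ℝ ℝ - LinearMap.snd ℝ ℝ ℝ) (by simp [Submodule.span_le])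
  invFun t := Submodule.Quotient.mk (t, 0)
  left_inv q := by
    obtain ⟨⟨a, b⟩, rfl⟩ := Submodule.Quotient.mk_surjective _ q
    rw [Submodule.liftQ_apply, Submodule.Quotient.eq, Submodule.mem_span_singleton]
    exact ⟨-b, by simp⟩
  right_inv t := by simp
  continuous_toFun := by
    refine (Submodule.isQuotientMap_mkQ _).continuous_iff.2 ?_
    exact continuous_fst.sub continuous_snd
  continuous_invFun := continuous_quot_mk.comp (continuous_id.prodMk continuous_const)

end FlagDressian

open FlagDressian in
theorem mainTheorem3 (n r : ℕ) (hr : r + 1 ≤ n) :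
    -- the coordinates on both sides are identified by `split`
    (∀ A : Type, Function.Bijective
      (split : (Sub (n + 1) (r + 1) → A) → (Sub n r → A) × (Sub n (r + 1) → A))) ∧
    -- `split` induces a well-defined map `φ` on `Ω`
    ∃ φ : Omega r n → TropProj (Sub n r) × TropProj (Sub n (r + 1)),
      (∀ (u : TropVec (Sub (n + 1) (r + 1))) (hu : TropProj.mk u ∈ Omega r n),
        ∃ (h' : ∃ I, (split u.1).1 I ≠ ⊤) (h : ∃ J, (split u.1).2 J ≠ ⊤),
          φ ⟨TropProj.mk u, hu⟩ =
            (TropProj.mk ⟨(split u.1).1, h'⟩, TropProj.mk ⟨(split u.1).2, h⟩)) ∧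
      -- `φ` restricts to a surjective map `π : Ω ∩ Dr(r + 1; n + 1) → FlDr(r, r + 1; n)`
      ∃ π : ↥(Omega r n ∩ Dr (r + 1) (n + 1)) → ↥(FlDr r (r + 1) n),
        (∀ x, (π x).1 = φ ⟨x.1, x.2.1⟩) ∧
        Function.Surjective π ∧
        -- the fiber of `π` over a point `(μ', μ)`
        ∀ (μ' : TropVec (Sub n r)) (μ : TropVec (Sub n (r + 1)))
          (hμ : (TropProj.mk μ', TropProj.mk μ) ∈ FlDr r (r + 1) n),
          (Subtype.val '' (π ⁻¹' {⟨(TropProj.mk μ', TropProj.mk μ), hμ⟩}) =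
            {p | ∃ a b : ℝ, p = fiberPoint μ' μ a b}) ∧
          ∃ (Φ : ((ℝ × ℝ) ⧸ Submodule.span ℝ {((1 : ℝ), (1 : ℝ))}) ≃ₜ
                ↥(π ⁻¹' {⟨(TropProj.mk μ', TropProj.mk μ), hμ⟩}))
            (Ψ : ↥(π ⁻¹' {⟨(TropProj.mk μ', TropProj.mk μ), hμ⟩}) ≃ₜ ℝ),
            ∀ a b : ℝ,
              (Φ (Submodule.Quotient.mk (a, b))).1.1 = fiberPoint μ' μ a b ∧
              Ψ (Φ (Submodule.Quotient.mk (a, b))) = a - b := by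
  refine ⟨fun A => split_bijective, ?_⟩
  have hφ : ∀ p : Omega r n, ∃ q : TropProj (Sub n r) × TropProj (Sub n (r + 1)),
      ∀ u : TropVec (Sub (n + 1) (r + 1)), TropProj.mk u = p.1 →
        ∃ (h' : ∃ I, (split u.1).1 I ≠ ⊤) (h : ∃ J, (split u.1).2 J ≠ ⊤),
          q = (TropProj.mk ⟨(split u.1).1, h'⟩, TropProj.mk ⟨(split u.1).2, h⟩) := by
    rintro ⟨p, hp⟩
    obtain ⟨u, rfl⟩ := TropProj.isQuotientMap_mk.surjective p
    obtain ⟨h', h⟩ := mk_mem_Omega_iff.1 hp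
    refine ⟨(TropProj.mk ⟨(split u.1).1, h'⟩, TropProj.mk ⟨(split u.1).2, h⟩), fun v hv => ?_⟩
    obtain ⟨k', k⟩ := mk_mem_Omega_iff.1 (show TropProj.mk v ∈ Omega r n from hv.symm ▸ hp)
    obtain ⟨c, hc⟩ := TropProj.mk_eq_mk.1 hv.symm
    exact ⟨k', k, Prod.ext (TropProj.mk_eq_mk.2 ⟨c, fun I => hc _⟩)
      (TropProj.mk_eq_mk.2 ⟨c, fun J => hc _⟩)⟩
  choose φ hφ using hφ
  refine ⟨φ, fun u hu => hφ ⟨_, hu⟩ u rfl, ?_⟩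
  have hπ : ∀ x : ↥(Omega r n ∩ Dr (r + 1) (n + 1)), φ ⟨x.1, x.2.1⟩ ∈ FlDr r (r + 1) n := by
    rintro ⟨p, hp, hD⟩
    obtain ⟨u, rfl⟩ := TropProj.isQuotientMap_mk.surjective p
    obtain ⟨h', h, e⟩ := hφ ⟨_, hp⟩ u rfl
    rw [e, mk_mem_FlDr_iff]
    exact satisfiesGP_iff_split.1 (mk_mem_Dr_iff.1 hD)
  -- every `a ⊙ μ' ⊕ b ⊙ μ` lies in the fiber over `(μ', μ)`
  have hpoint : ∀ (μ' : TropVec (Sub n r)) (μ : TropVec (Sub n (r + 1))),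
      (TropProj.mk μ', TropProj.mk μ) ∈ FlDr r (r + 1) n → ∀ a b : ℝ,
      ∃ x : ↥(Omega r n ∩ Dr (r + 1) (n + 1)), x.1 = fiberPoint μ' μ a b ∧
        φ ⟨x.1, x.2.1⟩ = (TropProj.mk μ', TropProj.mk μ) := by
    intro μ' μ hμ a b
    have hΩ := fiberPoint_mem_Omega μ' μ a b
    obtain ⟨h', h, e⟩ := hφ ⟨_, hΩ⟩ (fiberVec μ' μ a b) rfl
    rw [mk_split_fiberVec_fst, mk_split_fiberVec_snd] at e
    refine ⟨⟨_, hΩ, mk_mem_Dr_iff.2 (satisfiesGP_iff_split.2 ?_)⟩, rfl, e⟩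
    rw [← mk_split_fiberVec_fst μ' μ a b h', ← mk_split_fiberVec_snd μ' μ a b h] at hμ
    exact mk_mem_FlDr_iff.1 hμ
  refine ⟨fun x => ⟨_, hπ x⟩, fun x => rfl, ?_, ?_⟩
  · rintro ⟨⟨p', p⟩, hp⟩
    obtain ⟨μ', rfl⟩ := TropProj.isQuotientMap_mk.surjective p'
    obtain ⟨μ, rfl⟩ := TropProj.isQuotientMap_mk.surjective p
    obtain ⟨x, -, hx⟩ := hpoint μ' μ hp 0 0
    exact ⟨x, Subtype.ext hx⟩
  · intro μ' μ hμ
    have hfiber : Subtype.val '' ((fun x : ↥(Omega r n ∩ Dr (r + 1) (n + 1)) =>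
        (⟨_, hπ x⟩ : FlDr r (r + 1) n)) ⁻¹' {⟨(TropProj.mk μ', TropProj.mk μ), hμ⟩}) =
        {p | ∃ a b : ℝ, p = fiberPoint μ' μ a b} := by
      ext p
      constructor
      · rintro ⟨⟨p, hΩ, hD⟩, hx, rfl⟩
        obtain ⟨u, rfl⟩ := TropProj.isQuotientMap_mk.surjective p
        obtain ⟨h', h, e⟩ := hφ ⟨_, hΩ⟩ u rfl
        have hx' := e.symm.trans (congrArg Subtype.val hx)
        rw [Prod.mk.injEq] at hx'
        exact eq_fiberPoint μ' μ hx'.1 hx'.2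
      · rintro ⟨a, b, rfl⟩
        obtain ⟨x, hx, hx'⟩ := hpoint μ' μ hμ a b
        exact ⟨x, Subtype.ext hx', hx⟩
    refine ⟨hfiber, ?_⟩
    obtain ⟨Ψ, hΨ⟩ := exists_homeomorph_of_image_eq μ' μ hfiber
    refine ⟨quotientDiagonalHomeomorph.trans Ψ.symm, Ψ, fun a b => ⟨?_, ?_⟩⟩
    · exact (hΨ _).trans (fiberPoint_sub_zero μ' μ a b)
    · exact Ψ.apply_symm_apply _
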